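/- Let $(\Omega,\mathcal F,P)$ be a probability space, let $1\le p<\infty$ and let $q$ be the conjugate exponent, $p^{-1}+q^{-1}=1$ (so $1<q\le\infty$); write $\mathcal L_r=\mathcal L_r(\Omega,\mathcal F,P)$. Let $(\mathcal F_m)_{m\in\mathbb N}$ be a filtration with $\sigma\bigl(\bigcup_m\mathcal F_m\bigr)=\mathcal F$. Let $n\ge 2$ and $Z_1,\dots,Z_n\in\mathcal L_p$. For $i=1,\dots,n$ let $D_i$ be a convex subset of $\{Y\in\mathcal L_1: Y\ge 0,\ E[Y]=1\}$ that is closed in $\mathcal L_1$, is contained in $\mathcal L_q$ and satisfies $\sup\{\|Y\|_q: Y\in D_i\}<\infty$; assume that $\bigcap_{i=1}^n D_i\neq\emptyset$. For $m\in\mathbb N$ let $S(m)\subseteq\mathcal L_q^n$ be the set of optimal solutions of the incomplete-market dual problem $$\max\ \sum_{i=1}^n E[Z_iY_i]\quad\text{s.t. } Y_i\in D_i\ \forall i\ \text{ and } E[Y_i\mid\mathcal F_m]\ \text{is the same for all } i,$$ and let $S(\infty)\subseteq\mathcal L_q^n$ be the set of all $(Y_0,\dots,Y_0)$ where $Y_0$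 is an optimal solution of the complete-market dual problem $$\max\ E\Bigl[\Bigl(\sum_{i=1}^n Z_i\Bigr)Y_0\Bigr]\quad\text{s.t. } Y_0\in\bigcap_{i=1}^n D_i .$$ Equip $\mathbb N\cup\{\infty\}$ with its usual topology (the neighbourhoods of $\infty$ are the sets containing $\infty$ whose complement is a finite subset of $\mathbb N$), and $\mathcal L_q^n$ with its weak* topology as the dual of $\mathcal L_p^n$ under the pairing $(Y,W)\mapsto\sum_{i=1}^n E[W_iY_i]$. Then the multifunction $S$ is upper semicontinuous at $\infty$: for every weak* neighbourhood $V$ of the set $S(\infty)$ there is a neighbourhood $U$ of $\infty$ such that $S(m)\subseteq V$ for all $m\in U$. -/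

import Mathlib

open MeasureTheory ProbabilityTheory Topology
open scoped ENNReal NNReal

namespace RiskMarket

section

variable {Ω : Type*} {mΩ : MeasurableSpace Ω} (P : Measure Ω)

/-- `D₀`: the set of probability densities in `L¹`. -/
def densities : Set (Lp ℝ 1 P) :=
  {U | 0 ≤ᵐ[P] U ∧ ∫ ω, U ω ∂P = 1}

/-- A risk set: a closed (in `L¹`) convex set of densities which is contained in `L^q` and
bounded in the norm of `L^q`. -/
structure IsRiskSet (q : ℝ≥0∞) (D : Set (Lp ℝ 1 P)) : Prop where
  subset_densities : D ⊆ densities P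
  isClosed : IsClosed D
  convex : Convex ℝ D
  bounded : ∃ C : ℝ≥0, ∀ U ∈ D, eLpNorm U q P ≤ C

/-- The set `D ∩ L^q`, as a subset of `L^q`
(elements of different `L^p` spaces are compared as almost-everywhere classes). -/
def inLq (q : ℝ≥0∞) (D : Set (Lp ℝ 1 P)) : Set (Lp ℝ q P) :=
  {Y | ∃ U ∈ D, (U : Ω →ₘ[P] ℝ) = (Y : Ω →ₘ[P] ℝ)}

variable (p q : ℝ≥0∞) [hpq : ENNReal.HolderConjugate p q] (n : ℕ)

/-- The duality pairing `(Y, W) ↦ ∑ i, E[W i * Y i]` between `(L^q)ⁿ` and `(L^p)ⁿ`. -/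
noncomputable def pairing :
    (Fin n → Lp ℝ q P) →ₗ[ℝ] (Fin n → Lp ℝ p P) →ₗ[ℝ] ℝ :=
  have hint (f : Lp ℝ p P) (g : Lp ℝ q P) : Integrable (fun ω => f ω * g ω) P :=
    (Lp.memLp f).integrable_mul (Lp.memLp g)
  LinearMap.mk₂ ℝ (fun Y W => ∑ i, ∫ ω, W i ω * Y i ω ∂P)
    (fun Y Y' W => by
      rw [← Finset.sum_add_distrib]
      refine Finset.sum_congr rfl fun i _ => ?_
      rw [← integral_add (hint _ _) (hint _ _)]
      refine integral_congr_ae ?_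
      filter_upwards [Lp.coeFn_add (Y i) (Y' i)] with ω h
      simp only [Pi.add_apply] at h ⊢
      rw [h]; ring)
    (fun c Y W => by
      rw [Finset.smul_sum]
      refine Finset.sum_congr rfl fun i _ => ?_
      rw [← integral_smul]
      refine integral_congr_ae ?_
      filter_upwards [Lp.coeFn_smul c (Y i)] with ω h
      simp only [Pi.smul_apply, smul_eq_mul] at h ⊢
      rw [h]; ring)
    (fun Y W W' => by
      rw [← Finset.sum_add_distrib]
      refine Finset.sum_congr rfl fun i _ => ?_
      rw [← integral_add (hint _ _) (hint _ _)]
      refine integral_congr_ae ?_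
      filter_upwards [Lp.coeFn_add (W i) (W' i)] with ω h
      simp only [Pi.add_apply] at h ⊢
      rw [h]; ring)
    (fun c Y W => by
      rw [Finset.smul_sum]
      refine Finset.sum_congr rfl fun i _ => ?_
      rw [← integral_smul]
      refine integral_congr_ae ?_
      filter_upwards [Lp.coeFn_smul c (W i)] with ω h
      simp only [Pi.smul_apply, smul_eq_mul] at h ⊢
      rw [h]; ring)

/-- The space `(L^q)ⁿ` with its weak* topology as the dual of `(L^p)ⁿ` (for `p < ∞`): the coarsest
topology making `Y ↦ ∑ i, E[W i * Y i]` continuous for every `W ∈ (L^p)ⁿ`. -/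
abbrev LqWeakStar := WeakBilin (pairing P p q n)

variable {p n} (Z : Fin n → Lp ℝ p P) (D : Fin n → Set (Lp ℝ 1 P))

/-- Feasible set of the dual problem of the incomplete market in which the risks measurable
with respect to `𝒢` are traded. -/
def incompleteFeasible (𝒢 : MeasurableSpace Ω) : Set (Fin n → Lp ℝ q P) :=
  {Y | (∀ i, Y i ∈ inLq P q (D i)) ∧ ∀ i j, P[Y i | 𝒢] =ᵐ[P] P[Y j | 𝒢]}

/-- Optimal solutions of the dual problem of the incomplete market:
maximise `∑ i, E[Z i * Y i]` over the feasible set. -/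
def incompleteOptimal (𝒢 : MeasurableSpace Ω) : Set (Fin n → Lp ℝ q P) :=
  {Y | Y ∈ incompleteFeasible P q D 𝒢 ∧
    IsMaxOn (fun Y' : Fin n → Lp ℝ q P => ∑ i, ∫ ω, Z i ω * Y' i ω ∂P)
      (incompleteFeasible P q D 𝒢) Y}

/-- Optimal solutions of the dual problem of the complete market:
maximise `E[(∑ i, Z i) * Y₀]` over `⋂ i, D i`. -/
def completeOptimal : Set (Lp ℝ q P) :=
  {Y₀ | Y₀ ∈ ⋂ i, inLq P q (D i) ∧
    IsMaxOn (fun Y : Lp ℝ q P => ∫ ω, (∑ i, Z i ω) * Y ω ∂P) (⋂ i, inLq P q (D i)) Y₀}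

/-- The multifunction `S`: the optimal solutions of the dual problem of the market with
`σ`-field `ℱ m` for finite `m`, and of the complete market for `m = ∞`, where a common price `Y₀`
is regarded as the element `(Y₀, …, Y₀)` of `(L^q)ⁿ`. -/
def optimalPrices (ℱ : Filtration ℕ mΩ) : OnePoint ℕ → Set (LqWeakStar P p q n)
  | (m : ℕ) => incompleteOptimal P q Z D (ℱ m)
  | OnePoint.infty => (fun (Y₀ : Lp ℝ q P) (_ : Fin n) => Y₀) '' completeOptimal P q Z D

end

end RiskMarket

/-! ### Densities of functionals on `L^p` -/

namespace RiskMarket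

open Filter

section

variable {Ω : Type*} {mΩ : MeasurableSpace Ω} {P : Measure Ω} [IsFiniteMeasure P]
  {p : ℝ≥0∞} [Fact (1 ≤ p)]

/-! If semicontinuity failed, an open `O ⊇ S(∞)` would miss points `y m ∈ S(m)` for infinitely many
`m`. The sets `D i ∩ L^q` are weak* compact, so the `y m` have a limit `Y` along an ultrafilter. For
`A ∈ ℱ k` and `m ≥ k` all components of `y m` have the same integral over `A`; hence so do those of
`Y`, and these coincide because `ℱ` generates. The vector `(X, …, X)` with `X ∈ ⋂ D i` is feasible
for every `m`, so optimality passes to the limit and `Y ∈ S(∞) ⊆ O`, a contradiction.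

For compactness (`IsRiskSet.exists_weakStar_limit`), Alaoglu gives a limit functional on `L^p`, and
Radon–Nikodym gives it a density `g ∈ L¹`. Hahn–Banach in `L¹`, with separating functionals in `L^∞
⊆ L^p`, puts `g` in `D`, hence in `L^q`. -/

open Classical in
/-- The signed measure `A ↦ Λ 1_A` of a bounded linear functional `Λ` on `L^p`, `p < ∞`. -/
noncomputable def functionalMeasure (hp : p ≠ ⊤) (Λ : StrongDual ℝ (Lp ℝ p P)) :
    SignedMeasure Ω where
  measureOf' A := if h : MeasurableSet A then
    Λ (indicatorConstLp p h (measure_ne_top P A) 1) else 0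
  empty' := by simp
  not_measurable' A hA := by simp [hA]
  m_iUnion' A hA hdisj := by
    have hU : MeasurableSet (⋃ i, A i) := .iUnion hA
    have hUs (s : Finset ℕ) : MeasurableSet (⋃ i ∈ s, A i) := s.measurableSet_biUnion fun i _ => hA i
    have hsum (s : Finset ℕ) : ∑ i ∈ s, indicatorConstLp p (hA i) (measure_ne_top P _) (1 : ℝ) =
        indicatorConstLp p (hUs s) (measure_ne_top P _) 1 := by
      induction s using Finset.induction_on with
      | empty => simp
      | insert a s ha ih =>
        rw [Finset.sum_insert ha, ih, ← indicatorConstLp_disjoint_union]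
        · congr 1
          simp
        · rw [Set.disjoint_iUnion₂_right]
          exact fun i hi => hdisj (by rintro rfl; exact ha hi)
    simp only [hA, hU, dif_pos]
    -- Countable additivity needs `p < ∞`: only then does the vanishing measure of the remainders
    -- force convergence of the indicators in `L^p`.
    have hlim : Tendsto (fun s : Finset ℕ =>
        indicatorConstLp p (hUs s) (measure_ne_top P _) (1 : ℝ)) atTop
        (𝓝 (indicatorConstLp p hU (measure_ne_top P _) 1)) := by
      refine tendsto_indicatorConstLp_set hp ?_
      have h1 := tendsto_measure_iInter_atTop (μ := P)
        (s := fun s : Finset ℕ => (⋃ i, A i) \ ⋃ i ∈ s, A i)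
        (fun s => (hU.diff (hUs s)).nullMeasurableSet)
        (fun s t hst => Set.sdiff_subset_sdiff_right
          (Set.biUnion_subset_biUnion_left (fun i hi => hst hi))) ⟨∅, measure_ne_top _ _⟩
      have h2 : ⋂ s : Finset ℕ, ((⋃ i, A i) \ ⋃ i ∈ s, A i) = ∅ := by
        refine Set.eq_empty_of_forall_notMem fun x hx => ?_
        rw [Set.mem_iInter] at hx
        obtain ⟨i, hi⟩ := Set.mem_iUnion.1 (hx ∅).1
        exact (hx {i}).2 (by simpa using hi)
      rw [h2, measure_empty] at h1
      refine h1.congr fun s => ?_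
      simp only [Function.comp_apply]
      rw [symmDiff_def, sup_comm]
      congr 1
      have : (⋃ i ∈ s, A i) \ (⋃ i, A i) = ∅ :=
        Set.sdiff_eq_empty.2 (Set.iUnion₂_subset fun i _ => Set.subset_iUnion A i)
      simp [this]
    refine ((Λ.continuous.tendsto _).comp hlim).congr fun s => ?_
    simp only [Function.comp_apply]
    rw [← hsum, map_sum]

theorem functionalMeasure_apply (hp : p ≠ ⊤) (Λ : StrongDual ℝ (Lp ℝ p P)) {A : Set Ω}
    (hA : MeasurableSet A) :
    functionalMeasure hp Λ A = Λ (indicatorConstLp p hA (measure_ne_top P A) 1) :=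
  dif_pos hA

/-- A bounded linear functional on `L^p`, `p < ∞`, is given on indicators by an integrable
density. -/
theorem exists_integrable_density (hp : p ≠ ⊤) (Λ : StrongDual ℝ (Lp ℝ p P)) :
    ∃ g : Ω → ℝ, Integrable g P ∧ ∀ A (hA : MeasurableSet A),
      Λ (indicatorConstLp p hA (measure_ne_top P A) 1) = ∫ ω in A, g ω ∂P := by
  have hac : functionalMeasure hp Λ ≪ᵥ P.toENNRealVectorMeasure := by
    refine VectorMeasure.AbsolutelyContinuous.mk fun A hA h0 => ?_
    rw [Measure.toENNRealVectorMeasure_apply_measurable hA] at h0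
    have h1 : indicatorConstLp p hA (measure_ne_top P A) (1 : ℝ) = 0 := by
      have : A =ᵐ[P] (∅ : Set Ω) := ae_eq_empty.2 h0
      rw [← indicatorConstLp_empty (p := p) (μ := P) (c := (1 : ℝ))]
      exact (indicatorConstLp_inj hA _ .empty _ one_ne_zero).2 this
    rw [functionalMeasure_apply hp Λ hA, h1, map_zero]
  have hint : Integrable ((functionalMeasure hp Λ).rnDeriv P) P :=
    SignedMeasure.integrable_rnDeriv _ _
  refine ⟨_, hint, fun A hA => ?_⟩
  rw [← withDensityᵥ_apply hint hA, SignedMeasure.withDensityᵥ_rnDeriv_eq _ _ hac,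
    functionalMeasure_apply hp Λ hA]

/-- A density which represents a bounded linear functional on indicators represents it on every
function for which the integral exists. -/
theorem eq_integral_mul_of_indicator (hp : p ≠ ⊤) (Λ : StrongDual ℝ (Lp ℝ p P)) {g : Ω → ℝ}
    (hg : Integrable g P) (h : ∀ A (hA : MeasurableSet A),
      Λ (indicatorConstLp p hA (measure_ne_top P A) 1) = ∫ ω in A, g ω ∂P)
    (W : Lp ℝ p P) (hW : Integrable (fun ω => W ω * g ω) P) :
    Λ W = ∫ ω, W ω * g ω ∂P := by
  have simple_integrable (s : SimpleFunc Ω ℝ) : Integrable (fun ω => s ω * g ω) P := by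
    obtain ⟨C, hC⟩ := s.exists_forall_norm_le
    exact hg.bdd_mul (c := C) s.aestronglyMeasurable (Eventually.of_forall hC)
  have simple (s : SimpleFunc Ω ℝ) : ∀ hs : MemLp s p P,
      Λ (hs.toLp s) = ∫ ω, s ω * g ω ∂P := by
    induction s using SimpleFunc.induction with
    | const c hA =>
      rename_i A
      intro hs
      have h1 : hs.toLp _ = c • indicatorConstLp p hA (measure_ne_top P A) (1 : ℝ) := by
        rw [indicatorConstLp, ← MemLp.toLp_const_smul]
        refine MemLp.toLp_congr _ _ (Eventually.of_forall fun ω => ?_)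
        by_cases hω : ω ∈ A <;> simp [hω]
      rw [h1, map_smul, h, ← integral_indicator hA, ← integral_smul]
      refine integral_congr_ae (Eventually.of_forall fun ω => ?_)
      by_cases hω : ω ∈ A <;> simp [hω]
    | add hst ihs iht =>
      rename_i s t
      intro hs
      have h1 : MemLp s p P ∧ MemLp t p P :=
        (memLp_add_of_disjoint hst s.stronglyMeasurable t.stronglyMeasurable).1 hs
      have h2 : hs.toLp _ = h1.1.toLp s + h1.2.toLp t := by
        rw [← MemLp.toLp_add]
        rfl
      rw [h2, map_add, ihs, iht, ← integral_add (simple_integrable s) (simple_integrable t)]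
      simp [add_mul]
  have hWm : Measurable W := (Lp.stronglyMeasurable W).measurable
  have lim1 := (Λ.continuous.tendsto _).comp (SimpleFunc.tendsto_approxOn_range_Lp hp hWm (Lp.memLp W))
  rw [Lp.toLp_coeFn] at lim1
  have lim2 : Tendsto (fun k => ∫ ω, SimpleFunc.approxOn W hWm (Set.range W ∪ {0}) 0 (by simp) k ω
      * g ω ∂P) atTop (𝓝 (∫ ω, W ω * g ω ∂P)) := by
    -- The approximants satisfy `|s| ≤ 2|W|`, so integrability of `W * g` supplies the dominating
    -- function without knowing `g ∈ L^q`.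
    refine tendsto_integral_of_dominated_convergence (fun ω => 2 * ‖W ω * g ω‖)
      (fun k => (simple_integrable _).aestronglyMeasurable) (hW.norm.const_mul 2)
      (fun k => Eventually.of_forall fun ω => ?_) (Eventually.of_forall fun ω => ?_)
    · rw [norm_mul, norm_mul, ← mul_assoc, two_mul]
      gcongr
      exact SimpleFunc.norm_approxOn_zero_le hWm (by simp) ω k
    · exact (SimpleFunc.tendsto_approxOn hWm (by simp) (subset_closure (by simp))).mul_const _
  refine tendsto_nhds_unique lim1 (lim2.congr fun k => ?_)
  exact (simple _ _).symm

/-- The dual of `L¹` of a finite measure is `L^∞`. -/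
theorem exists_bounded_density (φ : StrongDual ℝ (Lp ℝ 1 P)) :
    ∃ h : Ω → ℝ, MemLp h ⊤ P ∧ ∀ W : Lp ℝ 1 P, φ W = ∫ ω, W ω * h ω ∂P := by
  obtain ⟨h, hint, hφ⟩ := exists_integrable_density ENNReal.one_ne_top φ
  -- The `L¹` norm of `1_A` is `P A`; writing `‖φ‖ * P A` as an integral over `A` turns this into a
  -- pointwise bound on `h`.
  have bound (A) (hA : MeasurableSet A) : |∫ ω in A, h ω ∂P| ≤ ∫ ω in A, ‖φ‖ ∂P := by
    rw [← hφ A hA, ← Real.norm_eq_abs]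
    refine (φ.le_opNorm _).trans ?_
    rw [norm_indicatorConstLp one_ne_zero ENNReal.one_ne_top]
    simp [mul_comm]
  have hle : h ≤ᵐ[P] fun _ => ‖φ‖ := ae_le_of_forall_setIntegral_le hint (integrable_const _)
    fun A hA _ => (le_abs_self _).trans (bound A hA)
  have hge : (fun ω => - h ω) ≤ᵐ[P] fun _ => ‖φ‖ :=
    ae_le_of_forall_setIntegral_le hint.neg (integrable_const _) fun A hA _ => by
      rw [integral_neg]
      exact (neg_le_abs _).trans (bound A hA)
  have hbdd : ∀ᵐ ω ∂P, ‖h ω‖ ≤ ‖φ‖ := by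
    filter_upwards [hle, hge] with ω h1 h2
    exact abs_le.2 ⟨by linarith, h1⟩
  refine ⟨h, memLp_top_of_bound hint.aestronglyMeasurable _ hbdd, fun W => ?_⟩
  exact eq_integral_mul_of_indicator ENNReal.one_ne_top φ hint hφ W
    ((L1.integrable_coeFn W).mul_bdd hint.aestronglyMeasurable hbdd)

end

end RiskMarket

/-! ### Weak* limits of prices -/

namespace RiskMarket

open Filter

section

variable {Ω : Type*} {mΩ : MeasurableSpace Ω} {P : Measure Ω} {p q : ℝ≥0∞}

theorem integrable_mul [ENNReal.HolderConjugate p q]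
    (W : Lp ℝ p P) (Y : Lp ℝ q P) : Integrable (fun ω => W ω * Y ω) P :=
  (Lp.memLp W).integrable_mul (Lp.memLp Y)

/-- A bounded family in `L^q` converges along every ultrafilter to a bounded linear functional
on `L^p`. -/
theorem exists_functional_limit [ENNReal.HolderConjugate p q]
    [Fact (1 ≤ p)] [Fact (1 ≤ q)] {ι : Type*} (u : Ultrafilter ι)
    (y : ι → Lp ℝ q P) {C : ℝ} (hy : ∀ᶠ k in u, ‖y k‖ ≤ C) :
    ∃ Λ : StrongDual ℝ (Lp ℝ p P), ∀ W : Lp ℝ p P,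
      Tendsto (fun k => ∫ ω, W ω * y k ω ∂P) u (𝓝 (Λ W)) := by
  let B := (ContinuousLinearMap.mul ℝ ℝ).lpPairing P q p
  let T : ι → WeakDual ℝ (Lp ℝ p P) := fun k => StrongDual.toWeakDual (B (y k))
  have hT (k : ι) (W : Lp ℝ p P) : T k W = ∫ ω, W ω * y k ω ∂P := by
    change B (y k) W = _
    rw [ContinuousLinearMap.lpPairing_eq_integral]
    simp [mul_comm]
  have hcomp := WeakDual.isCompact_closedBall (𝕜 := ℝ) (0 : StrongDual ℝ (Lp ℝ p P)) (‖B‖ * C)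
  obtain ⟨Λ, -, hΛ⟩ := hcomp.ultrafilter_le_nhds (u.map T) (by
    rw [le_principal_iff]
    change ∀ᶠ k in u, T k ∈ _
    filter_upwards [hy] with k hk
    change B (y k) ∈ Metric.closedBall 0 _
    rw [mem_closedBall_zero_iff]
    exact (B.le_opNorm _).trans (by gcongr))
  refine ⟨WeakDual.toStrongDual Λ, fun W => ?_⟩
  have h1 : Tendsto T u (𝓝 Λ) := hΛ
  exact (((WeakDual.eval_continuous W).tendsto Λ).comp h1).congr fun k => hT k W

/-- Risk sets are weak* compact in `L^q`, expressed by convergence along ultrafilters. -/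
theorem IsRiskSet.exists_weakStar_limit [IsFiniteMeasure P] [ENNReal.HolderConjugate p q]
    (hp : p ≠ ⊤) {D : Set (Lp ℝ 1 P)}
    (hD : IsRiskSet P q D) {ι : Type*} (u : Ultrafilter ι) (y : ι → Lp ℝ q P)
    (hy : ∀ᶠ k in u, y k ∈ inLq P q D) :
    ∃ Y ∈ inLq P q D, ∀ W : Lp ℝ p P,
      Tendsto (fun k => ∫ ω, W ω * y k ω ∂P) u (𝓝 (∫ ω, W ω * Y ω ∂P)) := by
  have : Fact (1 ≤ p) := ⟨ENNReal.HolderConjugate.one_le p q⟩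
  have : Fact (1 ≤ q) := ⟨ENNReal.HolderConjugate.one_le q p⟩
  obtain ⟨C, hC⟩ := hD.bounded
  have hbdd : ∀ᶠ k in u, ‖y k‖ ≤ C := by
    filter_upwards [hy] with k ⟨U, hU, hUy⟩
    rw [Lp.norm_def, ← hUy]
    exact ENNReal.toReal_le_coe_of_le_coe (hC U hU)
  obtain ⟨Λ, hΛ⟩ := exists_functional_limit (p := p) u y hbdd
  obtain ⟨g, hg, hgΛ⟩ := exists_integrable_density hp Λ
  -- A separating functional has a bounded density `h`, which is also a test function in `L^p`. Thus
  -- `φ g = Λ h` is a limit of values `φ U ≥ c` with `U ∈ D`, against `φ g < c`.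
  have hmem : hg.toL1 g ∈ D := by
    by_contra hnot
    obtain ⟨φ, c, hφc, hφD⟩ := geometric_hahn_banach_point_closed hD.convex hD.isClosed hnot
    obtain ⟨h, hh, hφ⟩ := exists_bounded_density φ
    have hhp : MemLp h p P := hh.mono_exponent le_top
    have hhg : Integrable (fun ω => h ω * g ω) P := hh.integrable_mul (memLp_one_iff_integrable.2 hg)
    have e1 : Λ (hhp.toLp h) = φ (hg.toL1 g) := by
      have hae : (fun ω => hhp.toLp h ω * g ω) =ᵐ[P] fun ω => h ω * g ω := by
        filter_upwards [hhp.coeFn_toLp] with ω hω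
        rw [hω]
      rw [eq_integral_mul_of_indicator hp Λ hg hgΛ _ (hhg.congr hae.symm), hφ]
      refine integral_congr_ae ?_
      filter_upwards [hhp.coeFn_toLp, hg.coeFn_toL1] with ω h1 h2
      rw [h1, h2, mul_comm]
    refine absurd (ge_of_tendsto (hΛ (hhp.toLp h)) ?_) (not_le.2 (e1 ▸ hφc))
    filter_upwards [hy] with k ⟨U, hU, hUy⟩
    refine (hφD U hU).le.trans_eq ?_
    rw [hφ]
    refine integral_congr_ae ?_
    filter_upwards [hhp.coeFn_toLp] with ω h1
    rw [h1, ← hUy, mul_comm]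
  -- Membership in `D` brings the `L^q` bound, so Hölder makes `W * g` integrable for every `W ∈
  -- L^p`.
  have hlt : eLpNorm (hg.toL1 g : Ω →ₘ[P] ℝ) q P < ⊤ := (hC _ hmem).trans_lt ENNReal.coe_lt_top
  let Y : Lp ℝ q P := ⟨(hg.toL1 g : Ω →ₘ[P] ℝ), Lp.mem_Lp_iff_eLpNorm_lt_top.2 hlt⟩
  refine ⟨Y, ⟨hg.toL1 g, hmem, rfl⟩, fun W => ?_⟩
  have hYg : (fun ω => W ω * Y ω) =ᵐ[P] fun ω => W ω * g ω := by
    filter_upwards [hg.coeFn_toL1] with ω hω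
    exact congrArg (W ω * ·) hω
  rw [integral_congr_ae hYg,
    ← eq_integral_mul_of_indicator hp Λ hg hgΛ W ((integrable_mul W Y).congr hYg)]
  exact hΛ W

/-- Elements of `L^q` which have the same conditional expectations along a generating filtration
coincide. -/
theorem eq_of_forall_condExp_ae_eq [IsFiniteMeasure P]
    [Fact (1 ≤ q)] {ℱ : Filtration ℕ mΩ} (hℱ : ⨆ m, ℱ m = mΩ)
    {Y Y' : Lp ℝ q P} (h : ∀ k, P[Y | ℱ k] =ᵐ[P] P[Y' | ℱ k]) : Y = Y' := by
  have conv (X : Lp ℝ q P) : ∀ᵐ ω ∂P, Tendsto (fun k => (P[X | ℱ k]) ω) atTop (𝓝 (X ω)) := by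
    -- Lévy's upward theorem.
    refine ((Lp.memLp X).integrable Fact.out).tendsto_ae_condExp ?_
    rw [hℱ]
    exact Lp.stronglyMeasurable X
  refine Lp.ext ?_
  filter_upwards [conv Y, conv Y', ae_all_iff.2 h] with ω h1 h2 h3
  exact tendsto_nhds_unique h1 (h2.congr fun k => (h3 k).symm)

theorem setIntegral_eq_integral_indicator_mul [IsFiniteMeasure P]
    {A : Set Ω} (hA : MeasurableSet A) (X : Lp ℝ q P) :
    ∫ ω, indicatorConstLp p hA (measure_ne_top P A) (1 : ℝ) ω * X ω ∂P = ∫ ω in A, X ω ∂P := by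
  rw [← integral_indicator hA]
  refine integral_congr_ae ?_
  filter_upwards [indicatorConstLp_coeFn (p := p) (hs := hA) (hμs := measure_ne_top P A)
    (c := (1 : ℝ))] with ω hω
  rw [hω]
  by_cases h : ω ∈ A <;> simp [h]

/-- Weak* limits of prices which agree conditionally on `ℱ m`, `m → ∞`, agree. -/
theorem eq_of_weakStar_limit [IsFiniteMeasure P] [ENNReal.HolderConjugate p q]
    {ℱ : Filtration ℕ mΩ} (hℱ : ⨆ m, ℱ m = mΩ) {l : Filter ℕ} [l.NeBot]
    (hl : l ≤ atTop) {y y' : ℕ → Lp ℝ q P} {Y Y' : Lp ℝ q P}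
    (hy : ∀ W : Lp ℝ p P, Tendsto (fun k => ∫ ω, W ω * y k ω ∂P) l (𝓝 (∫ ω, W ω * Y ω ∂P)))
    (hy' : ∀ W : Lp ℝ p P, Tendsto (fun k => ∫ ω, W ω * y' k ω ∂P) l (𝓝 (∫ ω, W ω * Y' ω ∂P)))
    (h : ∀ᶠ m in l, P[y m | ℱ m] =ᵐ[P] P[y' m | ℱ m]) : Y = Y' := by
  have : Fact (1 ≤ q) := ⟨ENNReal.HolderConjugate.one_le q p⟩
  have hint (X : Lp ℝ q P) : Integrable X P := (Lp.memLp X).integrable Fact.out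
  refine eq_of_forall_condExp_ae_eq hℱ fun k => ?_
  refine ae_eq_condExp_of_forall_setIntegral_eq (ℱ.le k) (hint Y')
    (fun _ _ _ => integrable_condExp.integrableOn) (fun A hA _ => ?_)
    stronglyMeasurable_condExp.aestronglyMeasurable
  rw [setIntegral_condExp (ℱ.le k) (hint Y) hA,
    ← setIntegral_eq_integral_indicator_mul (p := p) (ℱ.le k A hA) Y,
    ← setIntegral_eq_integral_indicator_mul (p := p) (ℱ.le k A hA) Y']
  refine tendsto_nhds_unique (hy _) ((hy' _).congr' ?_)
  -- The index `k` of the test set stays fixed while `m → ∞`: once `m ≥ k`, `A` lies in `ℱ m`.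
  filter_upwards [h, hl (eventually_ge_atTop k)] with m hm hkm
  have hAm : MeasurableSet[ℱ m] A := ℱ.mono hkm A hA
  rw [setIntegral_eq_integral_indicator_mul, setIntegral_eq_integral_indicator_mul,
    ← setIntegral_condExp (ℱ.le m) (hint _) hAm, ← setIntegral_condExp (ℱ.le m) (hint _) hAm]
  exact integral_congr_ae (ae_restrict_of_ae hm.symm)

theorem tendsto_weakStar [ENNReal.HolderConjugate p q]
    {n : ℕ} {ι : Type*} {l : Filter ι} {y : ι → LqWeakStar P p q n}
    {Y : LqWeakStar P p q n}
    (h : ∀ i, ∀ W : Lp ℝ p P, Tendsto (fun k => ∫ ω, W ω * (y k : Fin n → Lp ℝ q P) i ω ∂P) l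
      (𝓝 (∫ ω, W ω * (Y : Fin n → Lp ℝ q P) i ω ∂P))) : Tendsto y l (𝓝 Y) := by
  rw [nhds_induced, tendsto_comap_iff, tendsto_pi_nhds]
  intro W
  change Tendsto (fun k => ∑ i, ∫ ω, W i ω * (y k : Fin n → Lp ℝ q P) i ω ∂P) l
    (𝓝 (∑ i, ∫ ω, W i ω * (Y : Fin n → Lp ℝ q P) i ω ∂P))
  exact tendsto_finsetSum _ fun i _ => h i (W i)

theorem integral_sum_mul [ENNReal.HolderConjugate p q]
    {n : ℕ} (Z : Fin n → Lp ℝ p P) (Y : Lp ℝ q P) :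
    ∫ ω, (∑ i, Z i ω) * Y ω ∂P = ∑ i, ∫ ω, Z i ω * Y ω ∂P := by
  rw [← integral_finsetSum _ fun i _ => integrable_mul (Z i) Y]
  simp only [Finset.sum_mul]

/-- Weak* limits of optimal prices of the incomplete markets are optimal prices of the complete
market. -/
theorem exists_limit_mem_completeOptimal [IsFiniteMeasure P] [ENNReal.HolderConjugate p q]
    (hp : p ≠ ⊤) {n : ℕ} (hn : 0 < n)
    {ℱ : Filtration ℕ mΩ} (hℱ : ⨆ m, ℱ m = mΩ) (Z : Fin n → Lp ℝ p P)
    {D : Fin n → Set (Lp ℝ 1 P)} (hD : ∀ i, IsRiskSet P q (D i)) (u : Ultrafilter ℕ)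
    (hu : (u : Filter ℕ) ≤ atTop) (y : ℕ → Fin n → Lp ℝ q P)
    (hy : ∀ᶠ m in u, y m ∈ incompleteOptimal P q Z D (ℱ m)) :
    ∃ Y₀ ∈ completeOptimal P q Z D, ∀ i, ∀ W : Lp ℝ p P,
      Tendsto (fun m => ∫ ω, W ω * y m i ω ∂P) u (𝓝 (∫ ω, W ω * Y₀ ω ∂P)) := by
  choose Y hYD hY using fun i => (hD i).exists_weakStar_limit hp u (fun m => y m i)
    (hy.mono fun m hm => hm.1.1 i)
  have hconst (i : Fin n) : Y i = Y ⟨0, hn⟩ :=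
    eq_of_weakStar_limit hℱ hu (hY i) (hY _) (hy.mono fun m hm => hm.1.2 i _)
  refine ⟨Y ⟨0, hn⟩, ⟨Set.mem_iInter.2 fun i => hconst i ▸ hYD i, fun X hX => ?_⟩,
    fun i => hconst i ▸ hY i⟩
  simp only [Set.mem_ofPred_eq]
  rw [integral_sum_mul, integral_sum_mul]
  have hlim : Tendsto (fun m => ∑ i, ∫ ω, Z i ω * y m i ω ∂P) u
      (𝓝 (∑ i, ∫ ω, Z i ω * Y ⟨0, hn⟩ ω ∂P)) :=
    tendsto_finsetSum _ fun i _ => hconst i ▸ hY i (Z i)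
  refine ge_of_tendsto hlim (hy.mono fun m hm => ?_)
  exact isMaxOn_iff.1 hm.2 (fun _ => X) ⟨fun i => Set.mem_iInter.1 hX i, fun _ _ => EventuallyEq.rfl⟩

end

end RiskMarket

/-! ### Upper semicontinuity at `∞` -/

theorem mainTheorem3 {Ω : Type*} {mΩ : MeasurableSpace Ω} (P : Measure Ω) [IsProbabilityMeasure P]
    (p q : ℝ≥0∞) [ENNReal.HolderConjugate p q] (hp : p ≠ ⊤)
    (n : ℕ) (hn : 2 ≤ n)
    (ℱ : Filtration ℕ mΩ) (hℱ : ⨆ m, ℱ m = mΩ)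
    (Z : Fin n → Lp ℝ p P)
    (D : Fin n → Set (Lp ℝ 1 P)) (hD : ∀ i, RiskMarket.IsRiskSet P q (D i))
    (hne : (⋂ i, D i).Nonempty) :
    UpperHemicontinuousAt (RiskMarket.optimalPrices P q Z D ℱ) OnePoint.infty := by
  intro t ht
  obtain ⟨O, hO, hSO, hOt⟩ := mem_nhdsSet_iff_exists.1 ht
  suffices h : ∀ᶠ m in Filter.atTop, RiskMarket.optimalPrices P q Z D ℱ ((m : ℕ) : OnePoint ℕ) ⊆ O by
    rw [OnePoint.nhds_infty_eq, Filter.eventually_sup, Filter.eventually_map,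
      Filter.coclosedCompact_eq_cocompact, Filter.cocompact_eq_cofinite, Nat.cofinite_eq_atTop]
    exact ⟨h.mono fun m hm => mem_nhdsSet_iff_exists.2 ⟨O, hO, hm, hOt⟩, ht⟩
  by_contra hcon
  let bad : Set ℕ := {m | ¬ RiskMarket.optimalPrices P q Z D ℱ ((m : ℕ) : OnePoint ℕ) ⊆ O}
  have hbad : ∀ m, ∃ y : RiskMarket.LqWeakStar P p q n, m ∈ bad →
      y ∈ RiskMarket.optimalPrices P q Z D ℱ ((m : ℕ) : OnePoint ℕ) ∧ y ∉ O := fun m => by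
    by_cases hm : m ∈ bad
    · obtain ⟨y, hy⟩ := Set.not_subset.1 hm
      exact ⟨y, fun _ => hy⟩
    · exact ⟨0, fun h => absurd h hm⟩
  choose y hy using hbad
  have : (Filter.atTop ⊓ Filter.principal bad).NeBot :=
    Filter.frequently_mem_iff_neBot.1 (Filter.not_eventually.1 hcon)
  -- An ultrafilter replaces a subsequence, since bounded sets in `L^q` need not be weak*
  -- sequentially compact.
  let u := Ultrafilter.of (Filter.atTop ⊓ Filter.principal bad)
  have hu := Ultrafilter.of_le (Filter.atTop ⊓ Filter.principal bad)
  have hubad : ∀ᶠ m in (u : Filter ℕ), m ∈ bad :=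
    (hu.trans inf_le_right) (Filter.mem_principal_self bad)
  obtain ⟨Y₀, hY₀, hlim⟩ := RiskMarket.exists_limit_mem_completeOptimal hp (by omega) hℱ Z hD u
    (hu.trans inf_le_left) y (hubad.mono fun m hm => (hy m hm).1)
  have htend : Filter.Tendsto y u (𝓝 (fun _ => Y₀ : RiskMarket.LqWeakStar P p q n)) :=
    RiskMarket.tendsto_weakStar hlim
  have hmemO : (fun _ => Y₀ : RiskMarket.LqWeakStar P p q n) ∈ O := hSO ⟨Y₀, hY₀, rfl⟩
  obtain ⟨m, hmO, hm⟩ := ((htend.eventually (hO.mem_nhds hmemO)).and hubad).exists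
  exact (hy m hm).2 hmO
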